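/- Let $K$ be a field, let $n,m\ge 1$ be integers, and let $$S_{n,m}=K[x_1,\ldots,x_n,y_1,\ldots,y_m],\qquad I_{n,m}=(x_iy_j \,:\, 1\le i\le n,\ 1\le j\le m)\subset S_{n,m},$$ where $S_{n,m}$ is standard graded, so that $I_{n,m}$ is the edge ideal of the complete bipartite graph $K_{n,m}$. For a finitely generated graded $S_{n,m}$-module $M$, let $\operatorname{hdepth}(M)$ (the Hilbert depth of $M$) be the largest depth of a finitely generated graded $S_{n,m}$-module $N$ with the same Hilbert series as $M$. Put $h(n,m)=\operatorname{hdepth}(S_{n,m}/I_{n,m})$. Let $s\ge 0$ and $t$ be integers. 1. If $n=2s$, $m=s+t$ and $\frac{1-\sqrt{1+8s}}{2}<t<\frac{1+\sqrt{1+8s}}{2}$, then $h(n,m)=s$. 2. If $n=2s+1$, $m=s+1+t$ and $\frac{1-\sqrt{9+16s}}{2}<t<\frac{1+\sqrt{9+16s}}{2}$, then $h(n,m)=s+1$. -/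

import Mathlib

universe u

namespace HilbertDepth

open MvPolynomial

section Graded

attribute [local instance] MvPolynomial.gradedAlgebra

variable (σ : Type) (K : Type u) [Field K]

/-- A finitely generated `ℤ`-graded module over the standard graded polynomial ring
`S = K[X_i : i ∈ σ]` (every variable has degree `1`): an `S`-module `N` which is the internal
direct sum of `K`-subspaces `N_j`, `j ∈ ℤ`, with `S_i N_j ⊆ N_{i+j}`. -/
structure FGGradedModule where
  /-- the underlying module -/
  carrier : Type u
  [addCommGroup : AddCommGroup carrier]
  [moduleField : Module K carrier]
  [modulePoly : Module (MvPolynomial σ K) carrier]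
  [isScalarTower : IsScalarTower K (MvPolynomial σ K) carrier]
  [finite : Module.Finite (MvPolynomial σ K) carrier]
  /-- the homogeneous components -/
  component : ℤ → Submodule K carrier
  isInternal : DirectSum.IsInternal component
  smul_mem : ∀ (i : ℕ) (j : ℤ) (f : MvPolynomial σ K) (x : carrier),
    f.IsHomogeneous i → x ∈ component j → f • x ∈ component (i + j)

attribute [instance] FGGradedModule.addCommGroup FGGradedModule.moduleField
  FGGradedModule.modulePoly FGGradedModule.isScalarTower FGGradedModule.finite

variable {σ K}

/-- The coefficients of the Hilbert series `∑_j (dim_K N_j) t^j`. Two modules have the same Hilbert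
series if and only if these functions agree. -/
noncomputable def FGGradedModule.hilbertSeries (N : FGGradedModule σ K) : ℤ → ℕ :=
  fun j => Module.finrank K (N.component j)

/-- The depth of `N`: the supremum of the lengths of the `N`-regular sequences of elements of the
maximal ideal `(X_i : i ∈ σ)`. -/
noncomputable def FGGradedModule.depth (N : FGGradedModule σ K) : ℕ∞ :=
  ⨆ (rs : List (MvPolynomial σ K))
    (_ : (∀ r ∈ rs, r ∈ Ideal.span (Set.range (X : σ → MvPolynomial σ K))) ∧
      RingTheory.Sequence.IsRegular N.carrier rs), (rs.length : ℕ∞)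

/-- The Hilbert depth of `M`: the largest depth of a finitely generated graded module with the same
Hilbert series as `M`. -/
noncomputable def FGGradedModule.hdepth (M : FGGradedModule σ K) : ℕ∞ :=
  ⨆ (N : FGGradedModule σ K) (_ : N.hilbertSeries = M.hilbertSeries), N.depth

variable (σ K) in
/-- The standard grading of the polynomial ring, indexed by `ℤ`. -/
noncomputable def polyComponent : ℤ → Submodule K (MvPolynomial σ K)
  | Int.ofNat i => homogeneousSubmodule σ K i
  | Int.negSucc _ => ⊥

/-- The components `(S/I)_j`, the images of the `S_j`. -/
noncomputable def quotComponent (I : Ideal (MvPolynomial σ K)) (j : ℤ) :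
    Submodule K (MvPolynomial σ K ⧸ I) :=
  (polyComponent σ K j).map (Ideal.Quotient.mkₐ K I).toLinearMap

theorem quotComponent_smul_mem (I : Ideal (MvPolynomial σ K)) (i : ℕ) (j : ℤ)
    (f : MvPolynomial σ K) (x : MvPolynomial σ K ⧸ I) (hf : f.IsHomogeneous i)
    (hx : x ∈ quotComponent I j) : f • x ∈ quotComponent I (i + j) := by
  obtain ⟨g, hg, rfl⟩ := hx
  refine ⟨f * g, ?_, ?_⟩
  · rcases j with a | a
    · exact hf.mul hg
    · have h0 : g = 0 := hg
      rw [h0, mul_zero]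
      exact Submodule.zero_mem _
  · exact map_mul (Ideal.Quotient.mk I) f g

theorem quotComponent_isInternal {I : Ideal (MvPolynomial σ K)}
    (hI : I.IsHomogeneous (homogeneousSubmodule σ K)) :
    DirectSum.IsInternal (quotComponent I) := by
  have hcomp : ∀ (a : ℕ) (f : MvPolynomial σ K), f ∈ I → homogeneousComponent a f ∈ I := by
    intro a f hf
    have h := hI a hf
    rwa [← DirectSum.Decomposition.decompose'_eq, decomposition.decompose'_apply] at h
  let q : MvPolynomial σ K →ₗ[K] MvPolynomial σ K ⧸ I := (Ideal.Quotient.mkₐ K I).toLinearMap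
  have hq0 : ∀ f : MvPolynomial σ K, q f = 0 ↔ f ∈ I := fun f => Ideal.Quotient.eq_zero_iff_mem
  apply DirectSum.isInternal_submodule_of_iSupIndep_of_iSup_eq_top
  · rw [iSupIndep_def]
    intro i
    rw [Submodule.disjoint_def]
    rintro _ ⟨f, hf, rfl⟩ hx
    rcases i with a | a
    · have hle : (⨆ j, ⨆ (_ : j ≠ Int.ofNat a), quotComponent I j) ≤
          (LinearMap.ker (homogeneousComponent (R := K) (σ := σ) a)).map q := by
        refine iSup₂_le fun j hj => ?_
        rintro _ ⟨g, hg, rfl⟩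
        refine ⟨g, ?_, rfl⟩
        rw [SetLike.mem_coe, LinearMap.mem_ker]
        rcases j with b | b
        · have hab : a ≠ b := fun h => hj (by rw [h])
          rw [homogeneousComponent_of_mem hg, if_neg hab]
        · have h0 : g = 0 := hg
          rw [h0, map_zero]
      obtain ⟨v, hv, hvf⟩ := hle hx
      have h2 : f - v ∈ I := by
        rw [← hq0, map_sub, hvf]
        exact sub_self _
      have h3 := hcomp a _ h2
      rw [SetLike.mem_coe, LinearMap.mem_ker] at hv
      rw [map_sub, hv, sub_zero, homogeneousComponent_of_mem hf, if_pos rfl] at h3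
      exact (hq0 f).mpr h3
    · have h0 : f = 0 := hf
      rw [h0, map_zero]
  · rw [eq_top_iff]
    rintro x -
    obtain ⟨f, rfl⟩ := Ideal.Quotient.mk_surjective x
    change q f ∈ _
    rw [← sum_homogeneousComponent f, map_sum]
    refine Submodule.sum_mem _ fun a _ => ?_
    exact Submodule.mem_iSup_of_mem (Int.ofNat a)
      ⟨_, homogeneousComponent_isHomogeneous a f, rfl⟩

/-- The graded module `S/I` for a homogeneous ideal `I`. -/
noncomputable def quotientModule (I : Ideal (MvPolynomial σ K))
    (hI : I.IsHomogeneous (homogeneousSubmodule σ K)) : FGGradedModule σ K where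
  carrier := MvPolynomial σ K ⧸ I
  component := quotComponent I
  isInternal := quotComponent_isInternal hI
  smul_mem := quotComponent_smul_mem I

end Graded

section Bipartite

attribute [local instance] MvPolynomial.gradedAlgebra

variable (K : Type u) [Field K] (n m : ℕ)

/-- The edge ideal `I_{n,m} = (x_i y_j : 1 ≤ i ≤ n, 1 ≤ j ≤ m)` of the complete bipartite graph, in
`S_{n,m} = K[x_1, …, x_n, y_1, …, y_m]`; the variables `x` are indexed by the left summand and the
variables `y` by the right one. -/
noncomputable def bipartiteIdeal : Ideal (MvPolynomial (Fin n ⊕ Fin m) K) :=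
  Ideal.span (Set.range fun p : Fin n × Fin m => X (Sum.inl p.1) * X (Sum.inr p.2))

theorem bipartiteIdeal_isHomogeneous :
    (bipartiteIdeal K n m).IsHomogeneous (homogeneousSubmodule (Fin n ⊕ Fin m) K) := by
  apply Ideal.homogeneous_span
  rintro _ ⟨p, rfl⟩
  exact ⟨2, (isHomogeneous_X K _).mul (isHomogeneous_X K _)⟩

/-- `h(n,m) = hdepth (S_{n,m} / I_{n,m})`. -/
noncomputable def h : ℕ∞ :=
  (quotientModule (bipartiteIdeal K n m) (bipartiteIdeal_isHomogeneous K n m)).hdepth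

end Bipartite

end HilbertDepth

/-! Upper bound. If a graded module has depth at least `r + 1`, then `(1 - z) ^ (r + 1)` times its
Hilbert series has nonnegative coefficients. For the series of `S/I`, namely `(1 - z) ^ (-n) + (1 -
z) ^ (-m) - 1`, the coefficient of `z ^ 2` in this product is half of `t ^ 2 - t - 2 * s` (for `n =
2 * s`, `r = s`) or of `t ^ 2 - t - 4 * s - 2` (for `n = 2 * s + 1`, `r = s + 1`). The condition on
`t` says exactly that it is negative.

Nonnegativity holds because dividing by a regular linear form multiplies the series by `1 - z`.
Depth is measured by arbitrary elements of the irrelevant ideal, so these are traded for linear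
forms: after base change to an infinite field, prime avoidance gives a regular linear form, and
`exists_isWeaklyRegular_quotSMulTop` shows that it costs only one unit of depth. See
`iterate_backwardDiff_hilbertSeries_nonneg`.

Lower bound, valid for every `m`. Write `n = r + s` with `r ≤ s + 1`. The series is a sum of terms
`z ^ d * (1 - z) ^ (-e)` with `e ≥ r` (`invOneSubPow_add_sub_one_mem`). Each term is the series of a
shifted polynomial ring in `e` of the variables, made an `S`-module by killing the others. All these
rings can contain the same `r` variables, which then form a regular sequence on the direct sum. -/

namespace HilbertDepth

open RingTheory.Sequence Pointwise

/-! ### Exchange of regular elements, without locality or homogeneity -/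

section Exchange

variable {A : Type*} [CommRing A]

theorem mem_smul_top_iff {N : Type*} [AddCommGroup N] [Module A N] {a : A} {x : N} :
    x ∈ a • (⊤ : Submodule A N) ↔ ∃ y, a • y = x := by
  rw [Submodule.mem_smul_pointwise_iff_exists]
  simp

/-- If `a • x = c • y`, then regularity of `c` modulo `a` gives `y = a • z`, and cancelling `a`
leaves `x = c • z`. -/
theorem isSMulRegular_quotSMulTop_swap {N : Type*} [AddCommGroup N] [Module A N] {a c : A}
    (ha : IsSMulRegular N a) (h : IsSMulRegular (QuotSMulTop a N) c) :
    IsSMulRegular (QuotSMulTop c N) a := by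
  rw [isSMulRegular_quotient_iff_mem_of_smul_mem] at h ⊢
  intro x hx
  obtain ⟨y, hy⟩ := mem_smul_top_iff.mp hx
  obtain ⟨z, rfl⟩ := mem_smul_top_iff.mp (h y (mem_smul_top_iff.mpr ⟨x, hy.symm⟩))
  rw [smul_comm] at hy
  exact mem_smul_top_iff.mpr ⟨z, ha hy⟩

/-- The tail `rs` only sees the ideal `(a, c)`, which is symmetric. Outside the local case,
regularity of `c` on `N` itself has to be assumed. -/
theorem isWeaklyRegular_swap {N : Type*} [AddCommGroup N] [Module A N] {a c : A} {rs : List A}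
    (h : IsWeaklyRegular N (a :: c :: rs)) (hc : IsSMulRegular N c) :
    IsWeaklyRegular N (c :: a :: rs) := by
  have h' : IsWeaklyRegular N ([a, c] ++ rs) := h
  change IsWeaklyRegular N ([c, a] ++ rs)
  rw [isWeaklyRegular_append_iff] at h' ⊢
  have e : Ideal.ofList [a, c] = Ideal.ofList [c, a] := by
    simp [sup_comm]
  rw [← e]
  refine ⟨?_, h'.2⟩
  have h1 := h'.1
  rw [isWeaklyRegular_cons_iff, isWeaklyRegular_singleton_iff] at h1 ⊢
  exact ⟨hc, isSMulRegular_quotSMulTop_swap h1.1 h1.2⟩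

/-- If no nonzero element of `N / aN` is killed by `I`, the same holds for `N / bN`: both submodules
of elements killed by `I` are isomorphic to `Ext¹(A/I, N)`. -/
theorem socle_quotSMulTop_exchange {N : Type*} [AddCommGroup N] [Module A N] {I : Ideal A} {a b : A}
    (haI : a ∈ I) (ha : IsSMulRegular N a) (hb : IsSMulRegular N b)
    (h : ∀ x : QuotSMulTop a N, (∀ c ∈ I, c • x = 0) → x = 0) :
    ∀ x : QuotSMulTop b N, (∀ c ∈ I, c • x = 0) → x = 0 := by
  intro x hx
  obtain ⟨x, rfl⟩ := Submodule.Quotient.mk_surjective _ x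
  simp only [← Submodule.Quotient.mk_smul, Submodule.Quotient.mk_eq_zero, mem_smul_top_iff] at hx ⊢
  -- The relation `a • x = b • y` sends the class of `x` modulo `b` to the class of `y` modulo `a`;
  -- the latter is again killed by `I`, hence zero.
  obtain ⟨y, hy⟩ := hx a haI
  have hy0 := h (Submodule.Quotient.mk y) (by
    intro c hc
    rw [← Submodule.Quotient.mk_smul, Submodule.Quotient.mk_eq_zero, mem_smul_top_iff]
    obtain ⟨z, hz⟩ := hx c hc
    refine ⟨z, hb ?_⟩
    change b • a • z = b • c • y
    rw [smul_comm b a z, hz, smul_comm a c, ← hy, smul_comm])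
  rw [Submodule.Quotient.mk_eq_zero, mem_smul_top_iff] at hy0
  obtain ⟨z, rfl⟩ := hy0
  rw [smul_comm] at hy
  exact ⟨z, ha hy⟩

theorem isSMulRegular_prod {M N : Type*} [AddCommGroup N] [Module A N] [AddCommGroup M] [Module A M]
    {c : A} : IsSMulRegular (M × N) c ↔ IsSMulRegular M c ∧ IsSMulRegular N c := by
  simp only [isSMulRegular_iff_right_eq_zero_of_smul, Prod.forall, Prod.smul_mk, Prod.mk_eq_zero]
  refine ⟨fun h => ⟨fun m hm => (h m 0 ⟨hm, smul_zero _⟩).1, fun n hn => (h 0 n ⟨smul_zero _, hn⟩).2⟩,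
    fun h m n hmn => ⟨h.1 m hmn.1, h.2 n hmn.2⟩⟩

theorem socle_eq_zero_of_isSMulRegular {N : Type*} [AddCommGroup N] [Module A N] {I : Ideal A} {a : A}
    (haI : a ∈ I) (ha : IsSMulRegular N a) (x : N) (hx : ∀ c ∈ I, c • x = 0) : x = 0 :=
  ha.right_eq_zero_of_smul (hx a haI)

theorem socle_eq_zero_of_span {N : Type*} [AddCommGroup N] [Module A N] {L : Type*} [Field L] [Algebra L A]
    {V : Submodule L A}
    {x : N} (hx : ∀ c ∈ V, c • x = 0) : ∀ c ∈ Ideal.span (V : Set A), c • x = 0 := by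
  intro c hc
  induction hc using Submodule.span_induction with
  | mem c hc => exact hx c hc
  | zero => exact zero_smul _ _
  | add a b _ _ ha hb => rw [add_smul, ha, hb, add_zero]
  | smul a b _ hb => rw [smul_eq_mul, mul_smul, hb, smul_zero]

variable [IsNoetherianRing A] {L : Type*} [Field L] [Infinite L] [Algebra L A]

/-- Prime avoidance by elements of a linear subspace, over an infinite field. -/
theorem exists_isSMulRegular_of_span {N : Type*} [AddCommGroup N] [Module A N] [Module.Finite A N]
    (V : Submodule L A) (h : ∀ x : N, (∀ c ∈ V, c • x = 0) → x = 0) :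
    ∃ c ∈ V, IsSMulRegular N c := by
  classical
  by_contra! hcon
  have hfin := associatedPrimes.finite A N
  let s : Finset (Submodule L V) :=
    hfin.toFinset.image fun p => (p.restrictScalars L).comap V.subtype
  -- If `V` consisted of zero divisors, the finitely many associated primes would cover it. Over an
  -- infinite field one of them then contains `V`, and the element whose annihilator it is
  -- contradicts `h`.
  have hs : ⊤ ∈ s := by
    apply Subspace.top_mem_of_biUnion_eq_univ
    rw [Set.eq_univ_iff_forall]
    rintro ⟨c, hc⟩
    have h1 : c ∈ ⋃ p ∈ associatedPrimes A N, (p : Set A) := by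
      rw [biUnion_associatedPrimes_eq_compl_regular]
      exact hcon c hc
    simp only [Set.mem_iUnion] at h1
    obtain ⟨p, hp, hcp⟩ := h1
    simp only [Set.mem_iUnion]
    exact ⟨_, Finset.mem_image_of_mem _ (hfin.mem_toFinset.mpr hp), hcp⟩
  obtain ⟨p, hp, hpt⟩ := Finset.mem_image.mp hs
  rw [hfin.mem_toFinset] at hp
  obtain ⟨hprime, x, hx⟩ := isAssociatedPrime_iff_exists_injective_linearMap ..|>.mp hp
  have hx0 := h (x 1) fun c hc => by
    have hcp : c ∈ p := by
      have : (⟨c, hc⟩ : V) ∈ (p.restrictScalars L).comap V.subtype := hpt ▸ Submodule.mem_top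
      exact this
    rw [← map_smul]
    have : c • (1 : A ⧸ p) = 0 := by
      rw [Algebra.smul_def, mul_one]
      exact Ideal.Quotient.eq_zero_iff_mem.mpr hcp
    rw [this, map_zero]
  have h10 : (1 : A ⧸ p) = 0 := hx (by rw [hx0, map_zero])
  have := Ideal.Quotient.nontrivial_iff.mpr hprime.ne_top
  exact one_ne_zero h10

/-- Cutting down by a regular element of `I` lowers the `I`-depth by at most one. -/
theorem exists_isWeaklyRegular_quotSMulTop {V : Submodule L A} (r : ℕ) :
    ∀ {N : Type*} [AddCommGroup N] [Module A N] [Module.Finite A N] {l : A} {rs : List A},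
      l ∈ Ideal.span (V : Set A) → IsSMulRegular N l → IsWeaklyRegular N rs →
      (∀ a ∈ rs, a ∈ Ideal.span (V : Set A)) → rs.length = r + 1 →
      ∃ ts : List A, IsWeaklyRegular (QuotSMulTop l N) ts ∧
        (∀ a ∈ ts, a ∈ Ideal.span (V : Set A)) ∧ ts.length = r := by
  induction r with
  | zero => intros; exact ⟨[], .nil _ _, by simp, rfl⟩
  | succ r ih =>
    intro N _ _ _ l rs hlI hl hrs hI hlen
    obtain _ | ⟨a, rs⟩ := rs
    · simp at hlen
    obtain _ | ⟨b, rs'⟩ := rs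
    · simp at hlen
    have haI := hI a (by simp)
    have hbI := hI b (by simp)
    rw [isWeaklyRegular_cons_iff] at hrs
    have hb := ((isWeaklyRegular_cons_iff _ _ _).mp hrs.2).1
    have hsa := socle_eq_zero_of_isSMulRegular hbI hb
    have hsl := socle_quotSMulTop_exchange haI hrs.1 hl hsa
    -- Prime avoidance on the product gives one `c` regular on `N`, `N / aN` and `N / lN` at once.
    -- This `c` links `a` to `l`: the induction hypothesis is used on `N / aN` with `c`, then on `N
    -- / cN` with `l`, with swaps in between.
    obtain ⟨c, hcV, hc⟩ := exists_isSMulRegular_of_span (N := N × QuotSMulTop a N × QuotSMulTop l N) V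
      (by
        rintro ⟨x, y, z⟩ hxyz
        simp only [Prod.smul_mk, Prod.mk_eq_zero] at hxyz ⊢
        exact ⟨socle_eq_zero_of_isSMulRegular hlI hl _
            (socle_eq_zero_of_span fun c hc => (hxyz c hc).1),
          hsa _ (socle_eq_zero_of_span fun c hc => (hxyz c hc).2.1),
          hsl _ (socle_eq_zero_of_span fun c hc => (hxyz c hc).2.2)⟩)
    rw [isSMulRegular_prod, isSMulRegular_prod] at hc
    obtain ⟨hcN, hca, hcl⟩ := hc
    have hcI : c ∈ Ideal.span (V : Set A) := Ideal.subset_span hcV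
    obtain ⟨ts, hts, htsI, htsl⟩ := ih hcI hca hrs.2 (fun x hx => hI x (by simp [List.mem_cons.mp hx]))
      (by simpa using hlen)
    have h1 := isWeaklyRegular_swap ((hts.cons hca).cons hrs.1) hcN
    rw [isWeaklyRegular_cons_iff] at h1
    have hlc := isSMulRegular_quotSMulTop_swap hl hcl
    obtain ⟨us, hus, husI, husl⟩ := ih hlI hlc h1.2
      (fun x hx => by
        rcases List.mem_cons.mp hx with rfl | hx
        exacts [haI, htsI x hx]) (by simp [htsl])
    have h2 := isWeaklyRegular_swap ((hus.cons hlc).cons hcN) hl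
    rw [isWeaklyRegular_cons_iff] at h2
    exact ⟨c :: us, h2.2, fun x hx => by
      rcases List.mem_cons.mp hx with rfl | hx
      exacts [hcI, husI x hx], by simp [husl]⟩

end Exchange

end HilbertDepth

/-! ### Nonnegativity of `(1 - z) ^ r` times the Hilbert series -/

namespace HilbertDepth

open RingTheory.Sequence Pointwise

section Positivity

/-- The first difference of a function on `ℤ`, i.e. the multiplication of a Laurent series by
`1 - z`. -/
def backwardDiff (f : ℤ → ℤ) : ℤ → ℤ := fun j => f j - f (j - 1)

theorem iterate_backwardDiff_of_neg (r : ℕ) {f : ℤ → ℤ} (hf : ∀ j < 0, f j = 0) :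
    ∀ j < 0, (backwardDiff^[r] f) j = 0 := by
  induction r with
  | zero => exact hf
  | succ r ih =>
    intro j hj
    rw [Function.iterate_succ_apply', backwardDiff, ih j hj, ih (j - 1) (by omega), sub_zero]

theorem iterate_backwardDiff_zero (r : ℕ) {f : ℤ → ℤ} (hf : ∀ j < 0, f j = 0) :
    (backwardDiff^[r] f) 0 = f 0 := by
  induction r with
  | zero => rfl
  | succ r ih =>
    rw [Function.iterate_succ_apply', backwardDiff, ih,
      iterate_backwardDiff_of_neg r hf (0 - 1) (by norm_num), sub_zero]

theorem iterate_backwardDiff_one (r : ℕ) {f : ℤ → ℤ} (hf : ∀ j < 0, f j = 0) :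
    (backwardDiff^[r] f) 1 = f 1 - r * f 0 := by
  induction r with
  | zero => simp
  | succ r ih =>
    rw [Function.iterate_succ_apply', backwardDiff, ih, sub_self, iterate_backwardDiff_zero r hf]
    push_cast
    ring

/-- Doubling avoids the division in the binomial coefficient `r * (r - 1) / 2`. -/
theorem two_mul_iterate_backwardDiff_two (r : ℕ) {f : ℤ → ℤ} (hf : ∀ j < 0, f j = 0) :
    2 * (backwardDiff^[r] f) 2 = 2 * f 2 - 2 * r * f 1 + r * (r - 1) * f 0 := by
  induction r with
  | zero => simp
  | succ r ih =>
    rw [Function.iterate_succ_apply', backwardDiff, mul_sub, ih, show (2 : ℤ) - 1 = 1 by norm_num,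
      iterate_backwardDiff_one r hf]
    push_cast
    ring

variable {L : Type*} [Field L] {A : Type*} [CommRing A] [Algebra L A]

/-- The projections `π j` onto the homogeneous components of a graded module, with respect to which
the elements of `V` are linear forms. -/
structure IsGradedProjections (V : Submodule L A) {N : Type*} [AddCommGroup N] [Module L N]
    [Module A N] (π : ℤ → N →ₗ[L] N) : Prop where
  idem : ∀ j x, π j (π j x) = π j x
  ortho : ∀ i j x, i ≠ j → π i (π j x) = 0
  smul : ∀ v ∈ V, ∀ j x, π (j + 1) (v • x) = v • π j x
  finite : ∀ j, Module.Finite L (LinearMap.range (π j))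

variable {V : Submodule L A} {N : Type*} [AddCommGroup N] [Module L N] [Module A N]
  [IsScalarTower L A N]

/-- The projections preserve `lN` because `l` is linear, so they descend. In degree `j` the kernel
of the quotient map is `l N_{j-1}`, isomorphic to `N_{j-1}` since `l` is regular; this gives the
first difference. -/
theorem IsGradedProjections.exists_quotient {N' : Type*} [AddCommGroup N'] [Module L N']
    [Module A N'] {π : ℤ → N →ₗ[L] N} (hπ : IsGradedProjections V π)
    {l : A} (hl : l ∈ V) (hreg : IsSMulRegular N l) (q : N →ₗ[L] N') (hqs : Function.Surjective q)
    (hqA : ∀ (a : A) x, q (a • x) = a • q x) (hq0 : ∀ x, q x = 0 ↔ ∃ y, l • y = x) :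
    ∃ π' : ℤ → N' →ₗ[L] N', IsGradedProjections V π' ∧
      (fun j => (Module.finrank L (LinearMap.range (π' j)) : ℤ)) =
        backwardDiff fun j => (Module.finrank L (LinearMap.range (π j)) : ℤ) := by
  have hsmul : ∀ j x, π j (l • x) = l • π (j - 1) x := fun j x => by
    rw [← hπ.smul l hl, sub_add_cancel]
  have hex : ∀ j, ∃ p : N' →ₗ[L] N', ∀ x, p (q x) = q (π j x) := by
    intro j
    have hker : LinearMap.ker q ≤ LinearMap.ker (q ∘ₗ π j) := by
      intro x hx
      obtain ⟨y, rfl⟩ := (hq0 x).mp hx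
      rw [LinearMap.mem_ker, LinearMap.comp_apply, hsmul]
      exact (hq0 _).mpr ⟨_, rfl⟩
    refine ⟨(LinearMap.ker q).liftQ (q ∘ₗ π j) hker ∘ₗ
      (q.quotKerEquivOfSurjective hqs).symm.toLinearMap, fun x => ?_⟩
    have : (q.quotKerEquivOfSurjective hqs).symm (q x) = (LinearMap.ker q).mkQ x := by
      rw [LinearEquiv.symm_apply_eq]
      rfl
    rw [LinearMap.comp_apply, LinearEquiv.coe_coe, this]
    rfl
  choose π' hq using hex
  have hrange : ∀ j, LinearMap.range (π' j) = (LinearMap.range (π j)).map q := by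
    intro j
    rw [← LinearMap.range_comp, ← LinearMap.range_comp_of_range_eq_top (π' j)
      (LinearMap.range_eq_top.mpr hqs)]
    congr 1
    exact LinearMap.ext (hq j)
  refine ⟨π', ⟨?_, ?_, ?_, ?_⟩, ?_⟩
  · intro j x
    obtain ⟨x, rfl⟩ := hqs x
    rw [hq, hq, hπ.idem]
  · intro i j x hij
    obtain ⟨x, rfl⟩ := hqs x
    rw [hq, hq, hπ.ortho i j x hij, map_zero]
  · intro v hv j x
    obtain ⟨x, rfl⟩ := hqs x
    rw [← hqA, hq, hq, hπ.smul v hv, hqA]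
  · intro j
    have := hπ.finite j
    rw [hrange]
    infer_instance
  · funext j
    have := hπ.finite j
    have h1 := LinearMap.finrank_range_add_finrank_ker (q.domRestrict (LinearMap.range (π j)))
    rw [LinearMap.range_domRestrict, ← hrange] at h1
    have h2 : Module.finrank L (LinearMap.ker (q.domRestrict (LinearMap.range (π j)))) =
        Module.finrank L (LinearMap.range (π (j - 1))) := by
      let μ : N →ₗ[L] N := Algebra.lsmul L L N l
      have hμ : Function.Injective μ := hreg
      have hmap : (LinearMap.ker (q.domRestrict (LinearMap.range (π j)))).map
          (LinearMap.range (π j)).subtype = (LinearMap.range (π (j - 1))).map μ := ?_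
      · rw [(Submodule.equivMapOfInjective μ hμ (LinearMap.range (π (j - 1)))).finrank_eq,
          (Submodule.equivMapOfInjective _ (LinearMap.range (π j)).injective_subtype _).finrank_eq,
          hmap]
      ext x
      simp only [Submodule.mem_map, LinearMap.mem_ker]
      constructor
      · rintro ⟨⟨_, z, rfl⟩, hz, rfl⟩
        obtain ⟨y, hy⟩ := (hq0 _).mp hz
        refine ⟨π (j - 1) y, ⟨y, rfl⟩, ?_⟩
        change l • π (j - 1) y = π j z
        rw [← hsmul, hy]
        exact hπ.idem j z
      · rintro ⟨_, ⟨y, rfl⟩, rfl⟩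
        exact ⟨⟨_, l • y, hsmul j y⟩, (hq0 _).mpr ⟨_, rfl⟩, rfl⟩
    rw [backwardDiff, ← h1, h2]
    push_cast
    ring

theorem IsGradedProjections.exists_quotient_submodule {π : ℤ → N →ₗ[L] N}
    (hπ : IsGradedProjections V π) {l : A} (hl : l ∈ V) (hreg : IsSMulRegular N l)
    {P : Submodule A N} (hP : ∀ x, x ∈ P ↔ ∃ y, l • y = x) :
    ∃ π' : ℤ → (N ⧸ P) →ₗ[L] (N ⧸ P), IsGradedProjections V π' ∧
      (fun j => (Module.finrank L (LinearMap.range (π' j)) : ℤ)) =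
        backwardDiff fun j => (Module.finrank L (LinearMap.range (π j)) : ℤ) :=
  hπ.exists_quotient hl hreg (P.mkQ.restrictScalars L) P.mkQ_surjective (fun _ _ => rfl)
    fun x => (Submodule.Quotient.mk_eq_zero P).trans (hP x)

theorem IsGradedProjections.exists_quotSMulTop {π : ℤ → N →ₗ[L] N} (hπ : IsGradedProjections V π)
    {l : A} (hl : l ∈ V) (hreg : IsSMulRegular N l) :
    ∃ π' : ℤ → QuotSMulTop l N →ₗ[L] QuotSMulTop l N, IsGradedProjections V π' ∧
      (fun j => (Module.finrank L (LinearMap.range (π' j)) : ℤ)) =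
        backwardDiff fun j => (Module.finrank L (LinearMap.range (π j)) : ℤ) :=
  hπ.exists_quotient_submodule hl hreg fun _ => mem_smul_top_iff

/-- If a graded module over an algebra generated by linear forms has a weakly regular sequence of
length `r` in the irrelevant ideal, then `(1 - z) ^ r` times its Hilbert series is nonnegative. -/
theorem iterate_backwardDiff_finrank_nonneg [Infinite L] [IsNoetherianRing A] (r : ℕ) :
    ∀ {N : Type*} [AddCommGroup N] [Module L N] [Module A N] [IsScalarTower L A N]
      [Module.Finite A N] {π : ℤ → N →ₗ[L] N} (_ : IsGradedProjections V π) {rs : List A},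
      IsWeaklyRegular N rs → (∀ a ∈ rs, a ∈ Ideal.span (V : Set A)) → rs.length = r →
      ∀ j, 0 ≤ (backwardDiff^[r] fun j => (Module.finrank L (LinearMap.range (π j)) : ℤ)) j := by
  induction r with
  | zero => intros; exact Int.natCast_nonneg _
  | succ r ih =>
    intro N _ _ _ _ _ π hπ rs hrs hI hlen
    obtain _ | ⟨a, rs⟩ := rs
    · simp at hlen
    have ha := ((isWeaklyRegular_cons_iff _ _ _).mp hrs).1
    -- The element `a` need not be homogeneous; a linear form takes its place, so that the quotient
    -- is graded again.
    obtain ⟨l, hlV, hl⟩ := exists_isSMulRegular_of_span (N := N) V fun x hx =>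
      socle_eq_zero_of_isSMulRegular (hI a (by simp)) ha x (socle_eq_zero_of_span hx)
    obtain ⟨ts, hts, htsI, htsl⟩ :=
      exists_isWeaklyRegular_quotSMulTop r (Ideal.subset_span hlV) hl hrs hI hlen
    obtain ⟨π', hπ', he⟩ := hπ.exists_quotSMulTop hlV hl
    rw [Function.iterate_succ_apply, ← he]
    exact ih hπ' hts htsI htsl

end Positivity

end HilbertDepth

/-! ### Base change to an infinite field and the upper bound -/

namespace HilbertDepth

open RingTheory.Sequence Pointwise MvPolynomial TensorProduct

section Upper

attribute [local instance] MvPolynomial.algebraMvPolynomial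

variable {σ : Type} {K : Type u} [Field K]

namespace FGGradedModule

variable (N : FGGradedModule σ K)

/-- The projection of a graded module onto a homogeneous component. -/
noncomputable def proj (j : ℤ) : N.carrier →ₗ[K] N.carrier :=
  (N.component j).subtype ∘ₗ DirectSum.component K ℤ (fun i => N.component i) j ∘ₗ
    (LinearEquiv.ofBijective (DirectSum.coeLinearMap N.component) N.isInternal).symm.toLinearMap

variable {N}

theorem proj_mem (j : ℤ) (x : N.carrier) : N.proj j x ∈ N.component j :=
  Subtype.property _

theorem proj_of_mem {j : ℤ} {x : N.carrier} (hx : x ∈ N.component j) : N.proj j x = x :=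
  congrArg Subtype.val (N.isInternal.ofBijective_coeLinearMap_same ⟨x, hx⟩)

theorem proj_of_mem_ne {i j : ℤ} (hij : i ≠ j) {x : N.carrier} (hx : x ∈ N.component i) :
    N.proj j x = 0 :=
  congrArg Subtype.val (N.isInternal.ofBijective_coeLinearMap_of_ne hij ⟨x, hx⟩)

theorem range_proj (j : ℤ) : LinearMap.range (N.proj j) = N.component j := by
  apply le_antisymm
  · rintro _ ⟨x, rfl⟩
    exact proj_mem j x
  · intro x hx
    exact ⟨x, proj_of_mem hx⟩

theorem induction_component {p : N.carrier → Prop} (x : N.carrier)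
    (mem : ∀ j, ∀ y ∈ N.component j, p y) (zero : p 0) (add : ∀ y z, p y → p z → p (y + z)) :
    p x := by
  have hx : x ∈ ⨆ j, N.component j := by
    rw [N.isInternal.submodule_iSup_eq_top]
    exact Submodule.mem_top
  exact Submodule.iSup_induction _ (motive := p) hx mem zero add

theorem proj_smul {f : MvPolynomial σ K} {i : ℕ} (hf : f.IsHomogeneous i) (j : ℤ) (x : N.carrier) :
    N.proj (i + j) (f • x) = f • N.proj j x := by
  induction x using induction_component with
  | mem k y hy =>
    by_cases hkj : k = j
    · subst hkj
      rw [proj_of_mem hy, proj_of_mem (N.smul_mem i k f y hf hy)]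
    · rw [proj_of_mem_ne hkj hy, smul_zero,
        proj_of_mem_ne (by omega) (N.smul_mem i k f y hf hy)]
  | zero => simp
  | add y z hy hz => rw [smul_add, map_add, map_add, smul_add, hy, hz]

theorem finite_component [Finite σ] (j : ℤ) : Module.Finite K (N.component j) := by
  classical
  obtain ⟨s, hs⟩ := N.finite.fg_top
  have hfin : ∀ i : ℕ, Module.Finite K (homogeneousSubmodule σ K i) := fun i =>
    Module.Finite.iff_fg.mpr (homogeneousSubmodule_fg σ K i)
  have hclaim : ∀ x : N.carrier, ∃ W : Submodule K N.carrier, Module.Finite K W ∧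
      ∀ f : MvPolynomial σ K, N.proj j (f • x) ∈ W := by
    intro x
    induction x using induction_component with
    | mem k y hy =>
      -- The degree `j` part of `S y` is `S_{j-k} y`. For `j < k` the truncation gives degree `0`,
      -- which is harmless since the projection then vanishes.
      refine ⟨(homogeneousSubmodule σ K (j - k).toNat).map
        ((LinearMap.toSpanSingleton (MvPolynomial σ K) N.carrier y).restrictScalars K),
        inferInstance, fun f => ?_⟩
      induction f using MvPolynomial.induction_on' with
      | monomial m c =>
        have hm := isHomogeneous_monomial c (rfl : m.degree = m.degree)
        by_cases h : (m.degree : ℤ) + k = j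
        · subst h
          rw [proj_of_mem (N.smul_mem _ _ _ _ hm hy), add_sub_cancel_right, Int.toNat_natCast]
          exact ⟨_, hm, rfl⟩
        · rw [proj_of_mem_ne h (N.smul_mem _ _ _ _ hm hy)]
          exact Submodule.zero_mem _
      | add p q hp hq =>
        rw [add_smul, map_add]
        exact Submodule.add_mem _ hp hq
    | zero => exact ⟨⊥, inferInstance, fun f => by simp⟩
    | add y z hy hz =>
      obtain ⟨W₁, _, h₁⟩ := hy
      obtain ⟨W₂, _, h₂⟩ := hz
      refine ⟨W₁ ⊔ W₂, inferInstance, fun f => ?_⟩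
      rw [smul_add, map_add]
      exact Submodule.add_mem_sup (h₁ f) (h₂ f)
  choose W hW hWmem using hclaim
  have hle : N.component j ≤ ⨆ x : s, W x := by
    intro x hx
    rw [← proj_of_mem hx]
    have hxs : x ∈ Submodule.span (MvPolynomial σ K) (s : Set N.carrier) := hs ▸ Submodule.mem_top
    clear hx
    obtain ⟨c, rfl⟩ := Submodule.mem_span_finset'.mp hxs
    rw [map_sum]
    exact Submodule.sum_mem _ fun a _ => Submodule.mem_iSup_of_mem a (hWmem _ _)
  have : Module.Finite K (⨆ x : s, W x : Submodule K N.carrier) :=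
    Submodule.finite_iSup _
  exact Submodule.finiteDimensional_of_le hle

/-- The base change of the projections of a graded module along a field extension. -/
theorem exists_isGradedProjections_of_equiv [Finite σ] (N : FGGradedModule σ K)
    (L : Type u) [Field L] [Algebra K L] {B : Type u} [AddCommGroup B] [Module L B]
    [Module (MvPolynomial σ L) B] [IsScalarTower L (MvPolynomial σ L) B]
    (e : B ≃ₗ[L] L ⊗[K] N.carrier)
    (hX : ∀ (i : σ) (n : N.carrier), (X i : MvPolynomial σ L) • e.symm (1 ⊗ₜ n) =
      e.symm (1 ⊗ₜ ((X i : MvPolynomial σ K) • n))) :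
    ∃ π : ℤ → B →ₗ[L] B,
      IsGradedProjections (Submodule.span L (Set.range (X : σ → MvPolynomial σ L))) π ∧
      ∀ j, Module.finrank L (LinearMap.range (π j)) = N.hilbertSeries j := by
  let π : ℤ → B →ₗ[L] B := fun j => e.symm.toLinearMap ∘ₗ (N.proj j).baseChange L ∘ₗ e.toLinearMap
  have hπ : ∀ j n, π j (e.symm (1 ⊗ₜ n)) = e.symm (1 ⊗ₜ N.proj j n) := by
    intro j n
    change e.symm ((N.proj j).baseChange L (e (e.symm (1 ⊗ₜ n)))) = _
    rw [e.apply_symm_apply, LinearMap.baseChange_tmul]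
  have hext : ∀ f g : B →ₗ[L] B, (∀ n, f (e.symm (1 ⊗ₜ n)) = g (e.symm (1 ⊗ₜ n))) →
      ∀ x, f x = g x := by
    intro f g h x
    obtain ⟨x, rfl⟩ := e.symm.surjective x
    induction x with
    | zero => rw [map_zero, map_zero, map_zero]
    | add y z hy hz => rw [map_add, map_add, map_add, hy, hz]
    | tmul c n =>
      have : c ⊗ₜ[K] n = c • ((1 : L) ⊗ₜ[K] n) := by
        rw [TensorProduct.smul_tmul', smul_eq_mul, mul_one]
      rw [this, map_smul, map_smul, map_smul, h]
  have hr : ∀ j, Nonempty ((L ⊗[K] N.component j) ≃ₗ[L] LinearMap.range (π j)) := by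
    intro j
    let ι : (L ⊗[K] N.component j) →ₗ[L] L ⊗[K] N.carrier := (N.component j).subtype.baseChange L
    have hι : Function.Injective ι :=
      Module.Flat.lTensor_preserves_injective_linearMap _ (N.component j).injective_subtype
    have h1 : (N.proj j).baseChange L ∘ₗ ι = ι := by
      rw [← LinearMap.baseChange_comp]
      congr 1
      ext x
      exact proj_of_mem x.2
    have h2 : ι ∘ₗ ((N.proj j).codRestrict _ (proj_mem j)).baseChange L =
        (N.proj j).baseChange L := by
      rw [← LinearMap.baseChange_comp]
      rfl
    have hrange : LinearMap.range (e.symm.toLinearMap ∘ₗ ι) = LinearMap.range (π j) := by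
      apply le_antisymm
      · rintro _ ⟨x, rfl⟩
        refine ⟨e.symm (ι x), ?_⟩
        change e.symm ((N.proj j).baseChange L (e (e.symm (ι x)))) = e.symm (ι x)
        rw [e.apply_symm_apply]
        exact congrArg e.symm (LinearMap.congr_fun h1 x)
      · rintro _ ⟨x, rfl⟩
        exact ⟨_, congrArg e.symm (LinearMap.congr_fun h2 (e x))⟩
    exact ⟨(LinearEquiv.ofInjective (e.symm.toLinearMap ∘ₗ ι) (e.symm.injective.comp hι)).trans
      (LinearEquiv.ofEq _ _ hrange)⟩
  refine ⟨π, ⟨?_, ?_, ?_, ?_⟩, ?_⟩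
  · intro j
    refine hext (π j ∘ₗ π j) (π j) fun n => ?_
    rw [LinearMap.comp_apply, hπ, hπ, proj_of_mem (proj_mem j n)]
  · intro i j x hij
    refine hext (π i ∘ₗ π j) 0 (fun n => ?_) x
    rw [LinearMap.comp_apply, hπ, hπ, proj_of_mem_ne hij.symm (proj_mem j n), tmul_zero, map_zero]
    rfl
  · intro v hv j x
    induction hv using Submodule.span_induction with
    | mem v hv =>
      obtain ⟨i, rfl⟩ := hv
      refine hext (π (j + 1) ∘ₗ Algebra.lsmul L L B (X i)) (Algebra.lsmul L L B (X i) ∘ₗ π j)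
        (fun n => ?_) x
      change π (j + 1) ((X i : MvPolynomial σ L) • e.symm (1 ⊗ₜ n)) =
        (X i : MvPolynomial σ L) • π j (e.symm (1 ⊗ₜ n))
      rw [hX, hπ, hπ, hX, add_comm]
      exact congrArg (fun y => e.symm (1 ⊗ₜ y)) (proj_smul (isHomogeneous_X K i) j n)
    | zero => simp
    | add a b _ _ ha hb => rw [add_smul, map_add, ha, hb, add_smul]
    | smul c a _ ha => rw [smul_assoc, map_smul, ha, smul_assoc]
  · intro j
    have := finite_component (N := N) j
    exact Module.Finite.equiv (hr j).some
  · intro j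
    rw [← (hr j).some.finrank_eq, Module.finrank_baseChange]
    rfl

/-- The base change of a graded module along a field extension, together with its projections. -/
theorem exists_isGradedProjections_baseChange [Finite σ] (N : FGGradedModule σ K)
    (L : Type u) [Field L] [Algebra K L] :
    ∃ π : ℤ → (MvPolynomial σ L ⊗[MvPolynomial σ K] N.carrier) →ₗ[L]
        (MvPolynomial σ L ⊗[MvPolynomial σ K] N.carrier),
      IsGradedProjections (Submodule.span L (Set.range (X : σ → MvPolynomial σ L))) π ∧
      ∀ j, Module.finrank L (LinearMap.range (π j)) = N.hilbertSeries j := by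
  refine N.exists_isGradedProjections_of_equiv L
    -- Regular sequences are transported along `K[X] → L[X]`, whereas dimensions are read off from
    -- `L ⊗[K] N`; this isomorphism identifies the two base changes.
    (Algebra.IsPushout.cancelBaseChange K L (MvPolynomial σ K) (MvPolynomial σ L) N.carrier)
    fun i n => ?_
  rw [Algebra.IsPushout.cancelBaseChange_symm_tmul, Algebra.IsPushout.cancelBaseChange_symm_tmul,
    map_one, TensorProduct.tmul_smul, TensorProduct.smul_tmul', TensorProduct.smul_tmul',
    smul_eq_mul, mul_one, Algebra.smul_def, mul_one]
  congr 1
  exact (map_X _ i).symm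

/-- If a graded module has depth at least `r`, then `(1 - z) ^ r` times its Hilbert series has
nonnegative coefficients. -/
theorem iterate_backwardDiff_hilbertSeries_nonneg [Finite σ] (N : FGGradedModule σ K)
    {rs : List (MvPolynomial σ K)} (hrs : IsWeaklyRegular N.carrier rs)
    (hI : ∀ a ∈ rs, a ∈ Ideal.span (Set.range (X : σ → MvPolynomial σ K))) (j : ℤ) :
    0 ≤ (backwardDiff^[rs.length] fun j => (N.hilbertSeries j : ℤ)) j := by
  -- Any infinite extension would do. Flatness is enough, because only weak regularity has to
  -- survive.
  let L := AlgebraicClosure K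
  obtain ⟨π, hπ, hdim⟩ := N.exists_isGradedProjections_baseChange L
  have : Module.Flat (MvPolynomial σ K) (MvPolynomial σ L) :=
    Module.Flat.isBaseChange K (MvPolynomial σ K) L _ (Algebra.IsPushout.out (R := K)
      (S := MvPolynomial σ K) (R' := L) (S' := MvPolynomial σ L))
  have h := iterate_backwardDiff_finrank_nonneg rs.length hπ
    (hrs.of_flat_of_isBaseChange (TensorProduct.isBaseChange (MvPolynomial σ K) N.carrier
      (MvPolynomial σ L))) (fun a ha => ?_) (by simp) j
  · simpa only [hdim] using h
  obtain ⟨b, hb, rfl⟩ := List.mem_map.mp ha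
  have hb' := Ideal.mem_map_of_mem (algebraMap (MvPolynomial σ K) (MvPolynomial σ L)) (hI b hb)
  rw [Ideal.map_span] at hb'
  refine Ideal.span_mono ?_ hb'
  rintro _ ⟨_, ⟨i, rfl⟩, rfl⟩
  refine Submodule.subset_span ⟨i, ?_⟩
  exact (map_X _ i).symm

end FGGradedModule

/-- A negative second coefficient of `(1 - z) ^ r` times the Hilbert series bounds the Hilbert
depth. -/
theorem FGGradedModule.hdepth_le [Finite σ] (M : FGGradedModule σ K) (r : ℕ)
    (hneg : ∀ j < 0, M.hilbertSeries j = 0)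
    (h2 : 2 * (M.hilbertSeries 2 : ℤ) - 2 * (r + 1) * M.hilbertSeries 1 +
      (r + 1) * r * M.hilbertSeries 0 < 0) : M.hdepth ≤ r := by
  refine iSup₂_le fun N hN => iSup₂_le fun rs hrs => ?_
  rw [Nat.cast_le]
  by_contra! hlt
  have hwr : IsWeaklyRegular N.carrier (rs.take (r + 1)) := by
    have h := hrs.2.toIsWeaklyRegular
    rw [← List.take_append_drop (r + 1) rs, isWeaklyRegular_append_iff] at h
    exact h.1
  have h := N.iterate_backwardDiff_hilbertSeries_nonneg hwr
    (fun a ha => hrs.1 a (List.mem_of_mem_take ha)) 2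
  rw [List.length_take_of_le (by omega), hN] at h
  have h3 := two_mul_iterate_backwardDiff_two (r + 1) (f := fun j => (M.hilbertSeries j : ℤ))
    fun j hj => by simp only [hneg j hj, Nat.cast_zero]
  push_cast at h3
  linarith

end Upper

end HilbertDepth

/-! ### Hilbert functions and regular variables for monomial quotients -/

namespace HilbertDepth

open RingTheory.Sequence Pointwise MvPolynomial

section Monomial

variable {σ : Type} {K : Type u} [Field K]

attribute [local instance] MvPolynomial.gradedAlgebra

/-- The Hilbert function of the quotient by a monomial ideal counts the monomials outside. -/
theorem hilbertSeries_quotientModule_natCast {I : Ideal (MvPolynomial σ K)}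
    (hI : I.IsHomogeneous (homogeneousSubmodule σ K)) {U : (σ →₀ ℕ) → Prop}
    (hU : ∀ f, f ∈ I ↔ ∀ m ∈ f.support, U m) (k : ℕ) (T : Finset (σ →₀ ℕ))
    (hT : ∀ m, m ∈ T ↔ m.degree = k ∧ ¬ U m) :
    (quotientModule I hI).hilbertSeries k = T.card := by
  classical
  let v : T → MvPolynomial σ K ⧸ I := fun m => Ideal.Quotient.mkₐ K I (monomial m.1 1)
  have hv : LinearIndependent K v := by
    rw [Fintype.linearIndependent_iff]
    intro g hg m
    by_contra hm
    have h1 : Ideal.Quotient.mkₐ K I (∑ i : T, g i • monomial i.1 1) = 0 := by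
      rw [map_sum, ← hg]
      exact Finset.sum_congr rfl fun i _ => map_smul _ _ _
    have h2 := (hU _).mp (Ideal.Quotient.eq_zero_iff_mem.mp h1) m.1 (by
      rw [mem_support_iff, coeff_sum, Finset.sum_eq_single m]
      · simpa using hm
      · intro b _ hb
        rw [coeff_smul, coeff_monomial, if_neg fun h => hb (Subtype.ext h), smul_zero]
      · simp)
    exact ((hT m).mp m.2).2 h2
  have hspan : Submodule.span K (Set.range v) = quotComponent I k := by
    apply le_antisymm
    · rw [Submodule.span_le]
      rintro _ ⟨m, rfl⟩
      exact ⟨monomial m.1 1, isHomogeneous_monomial 1 ((hT m).mp m.2).1, rfl⟩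
    · rintro _ ⟨f, hf, rfl⟩
      have hf' : f.IsHomogeneous k := hf
      change Ideal.Quotient.mkₐ K I f ∈ _
      rw [f.as_sum, map_sum]
      refine Submodule.sum_mem _ fun m hm => ?_
      by_cases hUm : U m
      · have : Ideal.Quotient.mkₐ K I (monomial m (coeff m f)) = 0 := by
          refine Ideal.Quotient.eq_zero_iff_mem.mpr ((hU _).mpr fun m' hm' => ?_)
          rw [Finset.mem_singleton.mp (support_monomial_subset hm')]
          exact hUm
        rw [this]
        exact Submodule.zero_mem _
      · have hmT : m ∈ T := by
          refine (hT m).mpr ⟨?_, hUm⟩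
          rw [Finsupp.degree_eq_weight_one]
          exact hf' (mem_support_iff.mp hm)
        have : monomial m (coeff m f) = coeff m f • (monomial m 1 : MvPolynomial σ K) := by
          rw [smul_monomial, smul_eq_mul, mul_one]
        rw [this, map_smul]
        exact Submodule.smul_mem _ _ (Submodule.subset_span ⟨⟨m, hmT⟩, rfl⟩)
  change Module.finrank K (quotComponent I k) = _
  rw [← hspan, finrank_span_eq_card hv, Fintype.card_coe]

theorem hilbertSeries_quotientModule_of_neg {I : Ideal (MvPolynomial σ K)}
    (hI : I.IsHomogeneous (homogeneousSubmodule σ K)) (j : ℤ) (hj : j < 0) :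
    (quotientModule I hI).hilbertSeries j = 0 := by
  obtain ⟨a, rfl⟩ := Int.eq_negSucc_of_lt_zero hj
  change Module.finrank K (quotComponent I _) = 0
  rw [quotComponent, polyComponent, Submodule.map_bot, finrank_bot]

theorem mem_finsuppAntidiag_iff_degree [DecidableEq σ] (A : Finset σ) (k : ℕ) (m : σ →₀ ℕ) :
    m ∈ Finset.finsuppAntidiag A k ↔ m.degree = k ∧ m.support ⊆ A := by
  rw [Finset.mem_finsuppAntidiag]
  refine and_congr_left fun h => ?_
  rw [Finsupp.degree_apply, Finset.sum_subset h]
  intro i _ hi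
  exact Finsupp.notMem_support_iff.mp hi

/-- The ideal generated by the variables outside `A`. -/
noncomputable def varIdeal (K : Type u) [Field K] (A : Finset σ) : Ideal (MvPolynomial σ K) :=
  Ideal.span (X '' (A : Set σ)ᶜ)

theorem varIdeal_isHomogeneous (A : Finset σ) :
    (varIdeal K A).IsHomogeneous (homogeneousSubmodule σ K) := by
  apply Ideal.homogeneous_span
  rintro _ ⟨p, _, rfl⟩
  exact ⟨1, isHomogeneous_X K _⟩

theorem hilbertSeries_varIdeal (A : Finset σ) (k : ℕ) :
    (quotientModule (varIdeal K A) (varIdeal_isHomogeneous A)).hilbertSeries k =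
      A.card.multichoose k := by
  classical
  rw [← Finset.card_finsuppAntidiag_nat_eq_multichoose]
  refine hilbertSeries_quotientModule_natCast _ (fun f => mem_ideal_span_X_image) _ _ fun m => ?_
  rw [mem_finsuppAntidiag_iff_degree]
  refine and_congr_right fun _ => ?_
  simp only [Finset.subset_iff, Finsupp.mem_support_iff, Set.mem_compl_iff, SetLike.mem_coe]
  push Not
  exact forall_congr' fun i => not_imp_comm

theorem mk_mem_smul_top_iff {R : Type*} [CommRing R] (I J : Ideal R) (f : R) :
    Ideal.Quotient.mk I f ∈ (J • ⊤ : Submodule R (R ⧸ I)) ↔ f ∈ J ⊔ I := by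
  have h : (J • ⊤ : Submodule R (R ⧸ I)) = Submodule.map I.mkQ J := by
    rw [← Submodule.range_mkQ I, ← Submodule.map_top, ← Submodule.map_smul'', smul_eq_mul,
      Ideal.mul_top]
  have h2 := Submodule.comap_map_mkQ I J
  rw [h, sup_comm, ← h2]
  rfl

/-- Modulo the preceding variables, the ideal is still generated by variables, and the next one is
not among them. Membership is tested monomial by monomial, and multiplication by a different
variable does not change the test. -/
theorem isWeaklyRegular_varIdeal (A : Finset σ) {bs : List σ} (hbs : bs.Nodup)
    (hA : ∀ b ∈ bs, b ∈ A) :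
    IsWeaklyRegular (MvPolynomial σ K ⧸ varIdeal K A) (bs.map (X : σ → MvPolynomial σ K)) := by
  classical
  rw [isWeaklyRegular_iff]
  intro i hi
  rw [List.length_map] at hi
  have hJ : Ideal.ofList ((bs.map (X : σ → MvPolynomial σ K)).take i) ⊔ varIdeal K A =
      Ideal.span (X '' ({b | b ∈ bs.take i} ∪ (A : Set σ)ᶜ)) := by
    rw [Set.image_union, Ideal.span_union, varIdeal]
    congr 1
    rw [← List.map_take, Ideal.ofList]
    congr 1
    ext x
    exact List.mem_map
  rw [isSMulRegular_quotient_iff_mem_of_smul_mem]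
  intro x hx
  obtain ⟨f, rfl⟩ := Ideal.Quotient.mk_surjective x
  rw [mk_mem_smul_top_iff, hJ, mem_ideal_span_X_image]
  have hx' : Ideal.Quotient.mk (varIdeal K A) ((X bs[i] : MvPolynomial σ K) * f) ∈
    (Ideal.ofList ((bs.map (X : σ → MvPolynomial σ K)).take i) • ⊤ : Submodule (MvPolynomial σ K)
      (MvPolynomial σ K ⧸ varIdeal K A)) := by
    rw [List.getElem_map] at hx
    exact hx
  rw [mk_mem_smul_top_iff, hJ, mem_ideal_span_X_image] at hx'
  intro m hm
  obtain ⟨c, hc, hcm⟩ := hx' (Finsupp.single bs[i] 1 + m) (by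
    rw [mem_support_iff, coeff_X_mul]
    exact mem_support_iff.mp hm)
  refine ⟨c, hc, ?_⟩
  have hne : bs[i] ≠ c := by
    rintro rfl
    rcases hc with hc | hc
    · have := List.disjoint_take_drop hbs (le_refl i) hc
      apply this
      rw [List.mem_drop_iff_getElem]
      exact ⟨0, by simpa using hi, by simp⟩
    · exact hc (hA _ (List.getElem_mem hi))
  rwa [Finsupp.add_apply, Finsupp.single_eq_of_ne hne.symm, zero_add] at hcm

variable (K) in
/-- The Hilbert function of the edge ring of the complete bipartite graph. -/
theorem hilbertSeries_bipartiteIdeal (n m k : ℕ) :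
    ((quotientModule (bipartiteIdeal K n m) (bipartiteIdeal_isHomogeneous K n m)).hilbertSeries k : ℤ)
      = n.multichoose k + m.multichoose k - (0 : ℕ).multichoose k := by
  classical
  let Ax : Finset (Fin n ⊕ Fin m) := Finset.univ.map Function.Embedding.inl
  let Ay : Finset (Fin n ⊕ Fin m) := Finset.univ.map Function.Embedding.inr
  have hU : ∀ f, f ∈ bipartiteIdeal K n m ↔ ∀ d ∈ f.support,
      ∃ (i : Fin n) (j : Fin m), d (Sum.inl i) ≠ 0 ∧ d (Sum.inr j) ≠ 0 := by
    intro f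
    have h := mem_ideal_span_monomial_image (R := K) (x := f) (s := Set.range fun p : Fin n × Fin m =>
      Finsupp.single (Sum.inl p.1) 1 + Finsupp.single (Sum.inr p.2 : Fin n ⊕ Fin m) 1)
    rw [← Set.range_comp] at h
    have he : ((fun s => monomial s (1 : K)) ∘ fun p : Fin n × Fin m =>
        Finsupp.single (Sum.inl p.1) 1 + Finsupp.single (Sum.inr p.2 : Fin n ⊕ Fin m) 1) =
        fun p => X (Sum.inl p.1) * X (Sum.inr p.2) := by
      funext p
      simp only [Function.comp_apply, X, monomial_mul, mul_one]
    rw [he] at h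
    refine h.trans (forall₂_congr fun d _ => ?_)
    constructor
    · rintro ⟨_, ⟨p, rfl⟩, hp⟩
      have h1 := hp (Sum.inl p.1)
      have h2 := hp (Sum.inr p.2)
      simp at h1 h2
      exact ⟨p.1, p.2, by omega, by omega⟩
    · rintro ⟨i, j, hi, hj⟩
      refine ⟨_, ⟨(i, j), rfl⟩, ?_⟩
      rintro (a | a)
      · simp [Finsupp.single_apply]
        split_ifs with h
        · subst h; omega
        · omega
      · simp [Finsupp.single_apply]
        split_ifs with h
        · subst h; omega
        · omega
  -- A monomial survives when it involves only `x`'s or only `y`'s; the constant monomial is of both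
  -- kinds, whence the correction term.
  have hcard := hilbertSeries_quotientModule_natCast (bipartiteIdeal_isHomogeneous K n m) hU k
    (Finset.finsuppAntidiag Ax k ∪ Finset.finsuppAntidiag Ay k) (by
      intro d
      rw [Finset.mem_union, mem_finsuppAntidiag_iff_degree, mem_finsuppAntidiag_iff_degree,
        ← and_or_left]
      refine and_congr_right fun _ => ?_
      push Not
      constructor
      · rintro (h | h) i j hi
        · by_contra hj
          simpa [Ax] using h (Finsupp.mem_support_iff.mpr hj)
        · simpa [Ay] using h (Finsupp.mem_support_iff.mpr hi)
      · intro h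
        by_cases hx : ∃ i, d (Sum.inl i) ≠ 0
        · obtain ⟨i, hi⟩ := hx
          left
          rintro (a | a) ha
          · simp [Ax]
          · exact absurd (h i a hi) (Finsupp.mem_support_iff.mp ha)
        · right
          rintro (a | a) ha
          · exact absurd ⟨a, Finsupp.mem_support_iff.mp ha⟩ hx
          · simp [Ay])
  have hinter : Finset.finsuppAntidiag Ax k ∩ Finset.finsuppAntidiag Ay k =
      Finset.finsuppAntidiag ∅ k := by
    ext d
    rw [Finset.mem_inter, mem_finsuppAntidiag_iff_degree, mem_finsuppAntidiag_iff_degree,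
      mem_finsuppAntidiag_iff_degree, ← and_and_left, ← Finset.subset_inter_iff]
    have : Ax ∩ Ay = ∅ := by
      ext (a | a) <;> simp [Ax, Ay]
    rw [this]
  have hui := Finset.card_union_add_card_inter (Finset.finsuppAntidiag Ax k)
    (Finset.finsuppAntidiag Ay k)
  rw [hinter, ← hcard] at hui
  simp only [Finset.card_finsuppAntidiag_nat_eq_multichoose, Finset.card_empty, Ax, Ay,
    Finset.card_map, Finset.card_univ, Fintype.card_fin] at hui
  omega

end Monomial

end HilbertDepth

/-! ### Modules realizing a Hilbert series with prescribed regular variables -/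

namespace HilbertDepth

open RingTheory.Sequence Pointwise MvPolynomial

section Realizable

variable {σ : Type} {K : Type u} [Field K]

namespace FGGradedModule

/-- The shift `N(-1)` of a graded module. -/
noncomputable def shift (N : FGGradedModule σ K) : FGGradedModule σ K where
  carrier := N.carrier
  component j := N.component (j - 1)
  isInternal := by
    apply DirectSum.isInternal_submodule_of_iSupIndep_of_iSup_eq_top
    · exact N.isInternal.submodule_iSupIndep.comp (sub_left_injective (b := (1 : ℤ)))
    · rw [← N.isInternal.submodule_iSup_eq_top]
      exact (Equiv.subRight (1 : ℤ)).iSup_comp (g := N.component)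
  smul_mem i j f x hf hx := by
    rw [add_sub_assoc]
    exact N.smul_mem i (j - 1) f x hf hx

/-- The zero module. -/
noncomputable def zero (σ : Type) (K : Type u) [Field K] : FGGradedModule σ K where
  carrier := PUnit
  component _ := ⊥
  isInternal := by
    apply DirectSum.isInternal_submodule_of_iSupIndep_of_iSup_eq_top
    · exact fun i => disjoint_bot_left
    · exact Subsingleton.elim _ _
  smul_mem _ _ _ _ _ _ := Subsingleton.elim _ _

/-- The direct sum of two graded modules. -/
noncomputable def prod (M N : FGGradedModule σ K) : FGGradedModule σ K where
  carrier := M.carrier × N.carrier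
  component j := (M.component j).prod (N.component j)
  isInternal := by
    apply DirectSum.isInternal_submodule_of_iSupIndep_of_iSup_eq_top
    · rw [iSupIndep_def]
      intro i
      rw [Submodule.disjoint_def]
      rintro ⟨x, y⟩ hxy hs
      have hle : (⨆ j, ⨆ (_ : j ≠ i), (M.component j).prod (N.component j)) ≤
          (⨆ j, ⨆ (_ : j ≠ i), M.component j).prod (⨆ j, ⨆ (_ : j ≠ i), N.component j) :=
        iSup₂_le fun j hj => Submodule.prod_mono
          (le_iSup₂_of_le (f := fun j (_ : j ≠ i) => M.component j) j hj le_rfl)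
          (le_iSup₂_of_le (f := fun j (_ : j ≠ i) => N.component j) j hj le_rfl)
      have hM := Submodule.disjoint_def.mp (iSupIndep_def.mp M.isInternal.submodule_iSupIndep i)
      have hN := Submodule.disjoint_def.mp (iSupIndep_def.mp N.isInternal.submodule_iSupIndep i)
      exact Prod.ext (hM x hxy.1 (hle hs).1) (hN y hxy.2 (hle hs).2)
    · rw [eq_top_iff]
      rintro ⟨x, y⟩ -
      rw [← Prod.fst_add_snd (x, y)]
      refine Submodule.add_mem _ ?_ ?_
      · induction x using induction_component with
        | mem j x hx => exact Submodule.mem_iSup_of_mem j ⟨hx, Submodule.zero_mem _⟩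
        | zero => exact Submodule.zero_mem _
        | add a b ha hb => simpa using Submodule.add_mem _ ha hb
      · induction y using induction_component with
        | mem j x hx => exact Submodule.mem_iSup_of_mem j ⟨Submodule.zero_mem _, hx⟩
        | zero => exact Submodule.zero_mem _
        | add a b ha hb => simpa using Submodule.add_mem _ ha hb
  smul_mem i j f x hf hx := ⟨M.smul_mem i j f _ hf hx.1, N.smul_mem i j f _ hf hx.2⟩

theorem hilbertSeries_prod [Finite σ] (M N : FGGradedModule σ K) (j : ℤ) :
    (M.prod N).hilbertSeries j = M.hilbertSeries j + N.hilbertSeries j := by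
  have := finite_component (N := M) j
  have := finite_component (N := N) j
  change Module.finrank K ((M.component j).prod (N.component j)) = _
  let e : (M.component j).prod (N.component j) ≃ₗ[K] M.component j × N.component j :=
    { toFun := fun x => (⟨x.1.1, x.2.1⟩, ⟨x.1.2, x.2.2⟩)
      map_add' := fun _ _ => rfl
      map_smul' := fun _ _ => rfl
      invFun := fun x => ⟨(x.1.1, x.2.1), x.1.2, x.2.2⟩
      left_inv := fun _ => rfl
      right_inv := fun _ => rfl }
  rw [e.finrank_eq, Module.finrank_prod]
  rfl

end FGGradedModule

theorem mem_smul_top_prod {R M N : Type*} [CommRing R] [AddCommGroup M] [Module R M]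
    [AddCommGroup N] [Module R N] (J : Ideal R) (x : M × N) :
    x ∈ (J • ⊤ : Submodule R (M × N)) ↔
      x.1 ∈ (J • ⊤ : Submodule R M) ∧ x.2 ∈ (J • ⊤ : Submodule R N) := by
  constructor
  · intro hx
    have h1 := Submodule.mem_map_of_mem (f := LinearMap.fst R M N) hx
    have h2 := Submodule.mem_map_of_mem (f := LinearMap.snd R M N) hx
    rw [Submodule.map_smul''] at h1 h2
    exact ⟨Submodule.smul_mono le_rfl le_top h1, Submodule.smul_mono le_rfl le_top h2⟩
  · rintro ⟨h1, h2⟩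
    have h1 := Submodule.mem_map_of_mem (f := LinearMap.inl R M N) h1
    have h2 := Submodule.mem_map_of_mem (f := LinearMap.inr R M N) h2
    rw [Submodule.map_smul''] at h1 h2
    rw [← Prod.fst_add_snd x]
    exact Submodule.add_mem _ (Submodule.smul_mono le_rfl le_top h1)
      (Submodule.smul_mono le_rfl le_top h2)

theorem isWeaklyRegular_prod {R M N : Type*} [CommRing R] [AddCommGroup M] [Module R M]
    [AddCommGroup N] [Module R N] {rs : List R} (hM : IsWeaklyRegular M rs)
    (hN : IsWeaklyRegular N rs) : IsWeaklyRegular (M × N) rs := by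
  rw [isWeaklyRegular_iff] at hM hN ⊢
  intro i hi
  have h1 := hM i hi
  have h2 := hN i hi
  rw [isSMulRegular_quotient_iff_mem_of_smul_mem] at h1 h2 ⊢
  intro x hx
  rw [mem_smul_top_prod] at hx ⊢
  exact ⟨h1 _ hx.1, h2 _ hx.2⟩

variable (K) in
/-- The Hilbert series of graded modules in nonnegative degrees on which the variables in `bs` form
a weakly regular sequence. -/
noncomputable def realizable [Finite σ] (bs : List σ) : AddSubmonoid (PowerSeries ℤ) where
  carrier := {p | ∃ N : FGGradedModule σ K, (∀ j < 0, N.hilbertSeries j = 0) ∧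
    (∀ k : ℕ, (N.hilbertSeries k : ℤ) = PowerSeries.coeff k p) ∧
    IsWeaklyRegular N.carrier (bs.map (X : σ → MvPolynomial σ K))}
  zero_mem' := by
    refine ⟨.zero σ K, fun j _ => finrank_bot K PUnit.{u + 1}, fun k => ?_, ?_⟩
    · rw [map_zero, Nat.cast_eq_zero]
      exact finrank_bot K PUnit.{u + 1}
    · rw [isWeaklyRegular_iff]
      intro i hi
      rw [isSMulRegular_quotient_iff_mem_of_smul_mem]
      intro x _
      rw [show x = 0 from Subsingleton.elim (α := PUnit) _ _]
      exact Submodule.zero_mem _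
  add_mem' := by
    rintro p q ⟨M, hM0, hMp, hM⟩ ⟨N, hN0, hNq, hN⟩
    refine ⟨M.prod N, fun j hj => ?_, fun k => ?_, isWeaklyRegular_prod hM hN⟩
    · rw [FGGradedModule.hilbertSeries_prod, hM0 j hj, hN0 j hj]
    · rw [FGGradedModule.hilbertSeries_prod, map_add, Nat.cast_add, hMp, hNq]

variable [Finite σ] {bs : List σ}

theorem X_mul_mem_realizable {p : PowerSeries ℤ} (hp : p ∈ realizable K bs) :
    PowerSeries.X * p ∈ realizable K bs := by
  obtain ⟨N, hN0, hNp, hN⟩ := hp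
  refine ⟨N.shift, fun j hj => hN0 (j - 1) (by omega), fun k => ?_, hN⟩
  change ((N.hilbertSeries (k - 1) : ℕ) : ℤ) = _
  rcases k with _ | k
  · rw [PowerSeries.coeff_zero_X_mul, hN0 _ (by norm_num), Nat.cast_zero]
  · rw [PowerSeries.coeff_succ_X_mul, ← hNp]
    congr 2
    push_cast
    ring

/-- The polynomial ring in a set `A` of `e` variables containing `bs` realizes the series. -/
theorem mem_realizable_of_coeff_eq_multichoose [Fintype σ] (hbs : bs.Nodup) {e : ℕ}
    (h1 : bs.length ≤ e) (h2 : e ≤ Fintype.card σ) {p : PowerSeries ℤ}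
    (hp : ∀ k, PowerSeries.coeff k p = e.multichoose k) : p ∈ realizable K bs := by
  classical
  obtain ⟨A, hA, hAc⟩ := Finset.exists_superset_card_eq
    (by rwa [List.toFinset_card_of_nodup hbs] : bs.toFinset.card ≤ e) h2
  refine ⟨quotientModule (varIdeal K A) (varIdeal_isHomogeneous A),
    hilbertSeries_quotientModule_of_neg _, fun k => ?_,
    isWeaklyRegular_varIdeal A hbs fun b hb => hA (List.mem_toFinset.mpr hb)⟩
  rw [hilbertSeries_varIdeal, hp, hAc]

/-- A realization of the Hilbert series bounds the Hilbert depth from below. -/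
theorem le_hdepth_of_mem_realizable {p : PowerSeries ℤ} (hp : p ∈ realizable K bs)
    (M : FGGradedModule σ K) (hM0 : ∀ j < 0, M.hilbertSeries j = 0)
    (hMp : ∀ k : ℕ, (M.hilbertSeries k : ℤ) = PowerSeries.coeff k p)
    (h0 : M.hilbertSeries 0 ≠ 0) : (bs.length : ℕ∞) ≤ M.hdepth := by
  obtain ⟨N, hN0, hNp, hN⟩ := hp
  have hNM : N.hilbertSeries = M.hilbertSeries := by
    funext j
    rcases lt_or_ge j 0 with hj | hj
    · rw [hN0 j hj, hM0 j hj]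
    · lift j to ℕ using hj
      exact_mod_cast (hNp j).trans (hMp j).symm
  have hmem : ∀ r ∈ bs.map (X : σ → MvPolynomial σ K),
      r ∈ Ideal.span (Set.range (X : σ → MvPolynomial σ K)) := by
    intro r hr
    obtain ⟨b, _, rfl⟩ := List.mem_map.mp hr
    exact Ideal.subset_span ⟨b, rfl⟩
  -- Graded Nakayama: nothing lives in degree `-1`, so multiples by the irrelevant ideal have no
  -- part in degree `0`, while `N` does.
  have hproj : ∀ r ∈ Ideal.span (Set.range (X : σ → MvPolynomial σ K)), ∀ y : N.carrier,
      N.proj 0 (r • y) = 0 := by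
    intro r hr
    induction hr using Submodule.span_induction with
    | mem r hr =>
      obtain ⟨i, rfl⟩ := hr
      intro y
      have hbot : N.component (-1) = ⊥ := by
        have := FGGradedModule.finite_component (N := N) (-1)
        exact Submodule.finrank_eq_zero.mp (hN0 (-1) (by norm_num))
      have hy : N.proj (-1) y = 0 := by
        have := FGGradedModule.proj_mem (N := N) (-1) y
        rwa [hbot, Submodule.mem_bot] at this
      have h := FGGradedModule.proj_smul (isHomogeneous_X K i) (-1) y
      rw [hy, smul_zero] at h
      exact h
    | zero => intro y; rw [zero_smul, map_zero]
    | add a b _ _ ha hb => intro y; rw [add_smul, map_add, ha, hb, add_zero]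
    | smul a r _ hr => intro y; rw [smul_eq_mul, mul_comm, mul_smul, hr]
  have htop : (⊤ : Submodule (MvPolynomial σ K) N.carrier) ≠
      Ideal.ofList (bs.map (X : σ → MvPolynomial σ K)) • ⊤ := by
    intro htop
    have hz : ∀ x : N.carrier, N.proj 0 x = 0 := by
      intro x
      have hx : x ∈ Ideal.ofList (bs.map (X : σ → MvPolynomial σ K)) •
          (⊤ : Submodule (MvPolynomial σ K) N.carrier) := htop ▸ Submodule.mem_top
      refine Submodule.smul_induction_on hx (fun r hr y _ => hproj r ?_ y) fun x y hx hy => ?_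
      · exact Ideal.span_le.mpr hmem hr
      · rw [map_add, hx, hy, add_zero]
    apply h0
    rw [← hNM]
    change Module.finrank K (N.component 0) = 0
    rw [← FGGradedModule.range_proj, show N.proj 0 = 0 from LinearMap.ext hz, LinearMap.range_zero,
      finrank_bot]
  have h1 : (bs.length : ℕ∞) ≤ N.depth := by
    have := le_iSup₂ (f := fun (rs : List (MvPolynomial σ K))
      (_ : (∀ r ∈ rs, r ∈ Ideal.span (Set.range (X : σ → MvPolynomial σ K))) ∧
        IsRegular N.carrier rs) => (rs.length : ℕ∞)) _ ⟨hmem, hN, htop⟩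
    rwa [List.length_map] at this
  exact h1.trans (le_iSup₂ (f := fun (N : FGGradedModule σ K)
    (_ : N.hilbertSeries = M.hilbertSeries) => N.depth) N hNM)

end Realizable

end HilbertDepth

/-! ### Decomposition of the series -/

namespace HilbertDepth

open RingTheory.Sequence Pointwise

section Series

open PowerSeries

theorem coeff_invOneSubPow (e k : ℕ) :
    coeff k (invOneSubPow ℤ e).val = (e.multichoose k : ℤ) := by
  rcases e with _ | e
  · rw [invOneSubPow_zero, Units.val_one, coeff_one]
    rcases k with _ | k <;> simp
  · rw [invOneSubPow_val_succ_eq_mk_add_choose, coeff_mk, Nat.multichoose_eq,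
      show e + 1 + k - 1 = e + k by omega, Nat.choose_symm_add]

theorem coeff_one_sub_X_pow (r k : ℕ) :
    coeff k ((1 - X : PowerSeries ℤ) ^ r) = (-1) ^ k * (r.choose k : ℤ) := by
  have h : (1 - X : PowerSeries ℤ) ^ r = rescale (-1) ((1 + X) ^ r) := by
    rw [map_pow, map_add, map_one, rescale_X, map_neg, map_one, neg_one_mul, sub_eq_add_neg]
  rw [h, coeff_rescale]
  congr 1
  have := Polynomial.coeff_one_add_X_pow ℤ r k
  rw [← this, ← Polynomial.coeff_coe]
  simp

/-- Telescoping: consecutive powers differ by `z * (1 - z) ^ (-(e + 1))`, so `t` is the sum of the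
`(1 - z) ^ (-i)` for `1 ≤ i ≤ e`. -/
theorem exists_invOneSubPow_eq (s e : ℕ) (he : e ≤ s) :
    ∃ t ∈ AddSubmonoid.closure {p : PowerSeries ℤ | ∃ e ≤ s, p = (invOneSubPow ℤ e).val},
      (invOneSubPow ℤ e).val = 1 + X * t := by
  induction e with
  | zero => exact ⟨0, zero_mem _, by simp [invOneSubPow_zero]⟩
  | succ e ih =>
    obtain ⟨t, ht, h⟩ := ih (by omega)
    refine ⟨t + (invOneSubPow ℤ (e + 1)).val,
      add_mem ht (AddSubmonoid.subset_closure ⟨e + 1, he, rfl⟩), ?_⟩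
    have := one_sub_pow_mul_invOneSubPow_val_add_eq_invOneSubPow_val ℤ (d := e) 1
    rw [h, pow_one] at this
    linear_combination this

/-- A nonnegative perturbation of `(1 - z) ^ (-s)` by a polynomial `P` is a sum of series
`z ^ d * (1 - z) ^ (-e)` with `e ≤ s`. -/
theorem add_mem_of_coeff_nonneg {R : AddSubmonoid (PowerSeries ℤ)} (hX : ∀ p ∈ R, X * p ∈ R) {s : ℕ}
    (hR : ∀ e ≤ s, (invOneSubPow ℤ e).val ∈ R) (D : ℕ) :
    ∀ t ∈ AddSubmonoid.closure {p : PowerSeries ℤ | ∃ e ≤ s, p = (invOneSubPow ℤ e).val},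
      ∀ P : PowerSeries ℤ, (∀ k, D ≤ k → coeff k P = 0) → (∀ k, 0 ≤ coeff k (t + P)) → t + P ∈ R := by
  induction D with
  | zero =>
    intro t ht P hP _
    rw [show P = 0 from PowerSeries.ext fun k => by rw [hP k (Nat.zero_le k), map_zero], add_zero]
    refine AddSubmonoid.closure_le.mpr ?_ ht
    rintro _ ⟨e, he, rfl⟩
    exact hR e he
  | succ D ih =>
    intro t ht P hP hnn
    -- Splitting off the constant term leaves `X` times a sum of the same kind and lowers the degree
    -- of `P`; once `P` is used up, no sign condition is needed.
    have hpeel : ∃ c : ℤ, ∃ t' ∈ AddSubmonoid.closure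
        {p : PowerSeries ℤ | ∃ e ≤ s, p = (invOneSubPow ℤ e).val}, t = C c + X * t' := by
      clear hnn
      induction ht using AddSubmonoid.closure_induction with
      | mem p hp =>
        obtain ⟨e, he, rfl⟩ := hp
        obtain ⟨t, ht, h⟩ := exists_invOneSubPow_eq s e he
        exact ⟨1, t, ht, by rw [h, map_one]⟩
      | zero => exact ⟨0, 0, zero_mem _, by simp⟩
      | add p q _ _ hp hq =>
        obtain ⟨c, t, ht, rfl⟩ := hp
        obtain ⟨d, u, hu, rfl⟩ := hq
        exact ⟨c + d, t + u, add_mem ht hu, by rw [map_add]; ring⟩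
    obtain ⟨c, t', ht', rfl⟩ := hpeel
    let P' : PowerSeries ℤ := mk fun k => coeff (k + 1) P
    have hPP : P = X * P' + C (constantCoeff P) := eq_X_mul_shift_add_const P
    have heq : C c + X * t' + P = C (c + constantCoeff P) + X * (t' + P') := by
      conv_lhs => rw [hPP]
      rw [map_add]
      ring
    rw [heq] at hnn ⊢
    have h0 : 0 ≤ c + constantCoeff P := by simpa using hnn 0
    refine add_mem ?_ (hX _ (ih t' ht' P' (fun k hk => ?_) fun k => ?_))
    · obtain ⟨a, ha⟩ := Int.eq_ofNat_of_zero_le h0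
      have h1 : (1 : PowerSeries ℤ) ∈ R := by simpa [invOneSubPow_zero] using hR 0 (Nat.zero_le s)
      have := nsmul_mem h1 a
      rw [ha]
      simpa using this
    · rw [coeff_mk]
      exact hP (k + 1) (by omega)
    · have h := hnn (k + 1)
      rwa [map_add, coeff_C, if_neg k.succ_ne_zero, zero_add, coeff_succ_X_mul] at h

theorem choose_le_multichoose {r s k : ℕ} (hrs : r ≤ s + 1) (hk : 2 ≤ k) :
    r.choose k ≤ s.multichoose k := by
  rw [Nat.multichoose_eq]
  exact Nat.choose_le_choose k (by omega)

/-- Odd `k` only helps, and at `k = 0` the two terms cancel. For even `k ≥ 2` one has `r ≤ s + 1 ≤ s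
+ k - 1`; this is where `r ≤ s + 1` enters. -/
theorem coeff_sub_nonneg {r s : ℕ} (hrs : r ≤ s + 1) (k : ℕ) :
    0 ≤ (s.multichoose k : ℤ) - (-1) ^ k * r.choose k := by
  rcases Nat.even_or_odd k with hk | hk
  · rw [hk.neg_one_pow, one_mul, sub_nonneg, Nat.cast_le]
    rcases Nat.lt_or_ge k 2 with h | h
    · obtain rfl : k = 0 := by
        obtain ⟨a, rfl⟩ := hk
        omega
      simp
    · exact choose_le_multichoose hrs h
  · rw [hk.neg_one_pow, neg_one_mul, sub_neg_eq_add]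
    positivity

theorem coeff_add_sub_nonneg {r s u : ℕ} (hrs : r ≤ s + 1) (hur : u ≤ r) (k : ℕ) :
    0 ≤ (s.multichoose k : ℤ) + ((-1) ^ k * u.choose k - (-1) ^ k * r.choose k) := by
  rcases Nat.even_or_odd k with hk | hk
  · have := coeff_sub_nonneg hrs k
    rw [hk.neg_one_pow] at this ⊢
    have : (0 : ℤ) ≤ u.choose k := by positivity
    linarith
  · rw [hk.neg_one_pow]
    have : (u.choose k : ℤ) ≤ r.choose k := by exact_mod_cast Nat.choose_le_choose k hur
    have : (0 : ℤ) ≤ s.multichoose k := by positivity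
    linarith

/-- The Hilbert series of the edge ring is a sum of series `z ^ d * (1 - z) ^ (-e)`, `e ≥ r`. -/
theorem invOneSubPow_add_sub_one_mem {R : AddSubmonoid (PowerSeries ℤ)} (hX : ∀ p ∈ R, X * p ∈ R)
    {r s m : ℕ} (hrs : r ≤ s + 1)
    (hR : ∀ e, r ≤ e → e ≤ r + s + m → (invOneSubPow ℤ e).val ∈ R) :
    (invOneSubPow ℤ (r + s)).val + (invOneSubPow ℤ m).val - 1 ∈ R := by
  -- Factoring out `(1 - z) ^ (-r)` turns the requirement that exponents be at least `r` into no
  -- requirement, and `-1` into the polynomial `-(1 - z) ^ r`.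
  let R' : AddSubmonoid (PowerSeries ℤ) := R.comap (AddMonoidHom.mulLeft (invOneSubPow ℤ r).val)
  have hX' : ∀ p ∈ R', X * p ∈ R' := by
    intro p hp
    change _ * (X * p) ∈ R
    rw [mul_left_comm]
    exact hX _ hp
  have hmul : ∀ a b, (invOneSubPow ℤ a).val * (invOneSubPow ℤ b).val =
      (invOneSubPow ℤ (a + b)).val := fun a b => by rw [invOneSubPow_add, Units.val_mul]
  have hR' : ∀ e ≤ s, (invOneSubPow ℤ e).val ∈ R' := by
    intro e he
    change _ * _ ∈ R
    rw [hmul]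
    exact hR _ (by omega) (by omega)
  have hs : (invOneSubPow ℤ s).val ∈ AddSubmonoid.closure
      {p : PowerSeries ℤ | ∃ e ≤ s, p = (invOneSubPow ℤ e).val} :=
    AddSubmonoid.subset_closure ⟨s, le_rfl, rfl⟩
  have hinv : ∀ a b, (invOneSubPow ℤ (a + b)).val * (1 - X) ^ b = (invOneSubPow ℤ a).val :=
    fun a b => by rw [mul_comm, one_sub_pow_mul_invOneSubPow_val_add_eq_invOneSubPow_val]
  have hr1 : (invOneSubPow ℤ r).val * (1 - X) ^ r = 1 := by
    have := hinv 0 r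
    rwa [zero_add, invOneSubPow_zero, Units.val_one] at this
  -- For `m ≥ r` the term `(1 - z) ^ (-m)` is admissible by itself. Otherwise it becomes the
  -- polynomial `(1 - z) ^ (r - m)` after factoring and joins the perturbation.
  rcases le_or_gt r m with h | h
  · have h1 : (invOneSubPow ℤ s).val + -((1 - X) ^ r) ∈ R' := by
      refine add_mem_of_coeff_nonneg hX' hR' (r + 1) _ hs _ (fun k hk => ?_) fun k => ?_
      · rw [map_neg, coeff_one_sub_X_pow, Nat.choose_eq_zero_of_lt (by omega)]
        simp
      · rw [map_add, map_neg, coeff_one_sub_X_pow, coeff_invOneSubPow, ← sub_eq_add_neg]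
        exact coeff_sub_nonneg hrs k
    have h2 := add_mem (show _ * _ ∈ R from h1) (hR m h (by omega))
    rw [mul_add, mul_neg, hr1, hmul] at h2
    convert h2 using 1
    ring
  · have h1 : (invOneSubPow ℤ s).val + ((1 - X) ^ (r - m) - (1 - X) ^ r) ∈ R' := by
      refine add_mem_of_coeff_nonneg hX' hR' (r + 1) _ hs _ (fun k hk => ?_) fun k => ?_
      · rw [map_sub, coeff_one_sub_X_pow, coeff_one_sub_X_pow, Nat.choose_eq_zero_of_lt (by omega),
          Nat.choose_eq_zero_of_lt (by omega)]
        simp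
      · rw [map_add, map_sub, coeff_one_sub_X_pow, coeff_one_sub_X_pow, coeff_invOneSubPow]
        exact coeff_add_sub_nonneg hrs (by omega) k
    have h2 : _ * _ ∈ R := h1
    have h3 := hinv m (r - m)
    rw [Nat.add_sub_cancel' h.le] at h3
    rw [mul_add, mul_sub, hr1, hmul, h3] at h2
    convert h2 using 1
    ring

end Series

/-! ### The two bounds and the theorem -/

section Main

variable (K : Type u) [Field K]

theorem le_h {n m r s : ℕ} (hn : n = r + s) (hrs : r ≤ s + 1) : (r : ℕ∞) ≤ h K n m := by
  obtain ⟨B, -, hB⟩ := Finset.exists_subset_card_eq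
    (s := (Finset.univ : Finset (Fin n ⊕ Fin m))) (n := r) (by simp; omega)
  have hlen : B.toList.length = r := by rw [Finset.length_toList, hB]
  have hmem : (PowerSeries.invOneSubPow ℤ (r + s)).val + (PowerSeries.invOneSubPow ℤ m).val - 1 ∈
      realizable K B.toList := by
    refine invOneSubPow_add_sub_one_mem (fun p hp => X_mul_mem_realizable hp) hrs fun e h1 h2 => ?_
    exact mem_realizable_of_coeff_eq_multichoose B.nodup_toList (by omega) (by simp; omega)
      (coeff_invOneSubPow e)
  have h := le_hdepth_of_mem_realizable hmem
    (quotientModule (bipartiteIdeal K n m) (bipartiteIdeal_isHomogeneous K n m))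
    (hilbertSeries_quotientModule_of_neg _) (fun k => by
      rw [hilbertSeries_bipartiteIdeal, map_sub, map_add, coeff_invOneSubPow, coeff_invOneSubPow,
        ← hn, ← coeff_invOneSubPow 0, PowerSeries.invOneSubPow_zero, Units.val_one]) (by
      have := hilbertSeries_bipartiteIdeal K n m 0
      simp only [Nat.multichoose_zero_right] at this
      intro h0
      rw [Nat.cast_zero, h0] at this
      norm_num at this)
  rwa [hlen] at h

/-- The hypothesis says that twice the coefficient of `z ^ 2` in `(1 - z) ^ (r + 1)` times the
Hilbert series is negative. -/
theorem h_le {n m r : ℕ}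
    (hneg : (n : ℤ) * (n + 1) + m * (m + 1) - 2 * (r + 1) * (n + m) + (r + 1) * r < 0) :
    h K n m ≤ r := by
  refine FGGradedModule.hdepth_le _ r (hilbertSeries_quotientModule_of_neg _) ?_
  have h2 : ∀ a : ℕ, 2 * (a.multichoose 2 : ℤ) = a * (a + 1) := by
    intro a
    rw [Nat.multichoose_eq, show a + 2 - 1 = a + 1 by omega]
    have h := Nat.choose_two_right (a + 1)
    have h3 := Nat.even_mul_succ_self a
    rw [Nat.add_sub_cancel, mul_comm] at h
    have h4 := Nat.div_mul_cancel h3.two_dvd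
    rw [← h] at h4
    zify at h4
    linarith
  have e0 := hilbertSeries_bipartiteIdeal K n m 0
  have e1 := hilbertSeries_bipartiteIdeal K n m 1
  have e2 := hilbertSeries_bipartiteIdeal K n m 2
  simp only [Nat.multichoose_zero_right, Nat.multichoose_one_right, Nat.multichoose_zero_succ,
    Nat.cast_zero, Nat.cast_one, Nat.cast_ofNat] at e0 e1 e2
  rw [e0, e1, e2]
  have := h2 n
  have := h2 m
  linarith

theorem sq_lt_of_mem_Ioo {a : ℝ} (ha : 0 ≤ a) {t : ℤ}
    (ht : (t : ℝ) ∈ Set.Ioo ((1 - √a) / 2) ((1 + √a) / 2)) : (2 * (t : ℝ) - 1) ^ 2 < a := by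
  rw [← Real.sq_sqrt ha]
  exact sq_lt_sq' (by linarith [ht.1]) (by linarith [ht.2])

end Main

end HilbertDepth

theorem theorem3p1 (K : Type*) [Field K] (n m : ℕ) (hn : 1 ≤ n) (hm : 1 ≤ m) (s : ℕ) (t : ℤ) :
    (n = 2 * s → (m : ℤ) = s + t →
      (t : ℝ) ∈ Set.Ioo ((1 - √(1 + 8 * (s : ℝ))) / 2) ((1 + √(1 + 8 * (s : ℝ))) / 2) →
      HilbertDepth.h K n m = (s : ℕ∞)) ∧
    (n = 2 * s + 1 → (m : ℤ) = s + 1 + t →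
      (t : ℝ) ∈ Set.Ioo ((1 - √(9 + 16 * (s : ℝ))) / 2) ((1 + √(9 + 16 * (s : ℝ))) / 2) →
      HilbertDepth.h K n m = ((s + 1 : ℕ) : ℕ∞)) := by
  refine ⟨fun hns hmt ht => ?_, fun hns hmt ht => ?_⟩
  · have h1 : (2 * t - 1) ^ 2 < 1 + 8 * (s : ℤ) := by
      exact_mod_cast HilbertDepth.sq_lt_of_mem_Ioo (by positivity) ht
    -- With `r = s` the quadratic expression in `h_le` is `t ^ 2 - t - 2 * s`; the lower bound
    -- splits `n = s + s`.
    refine le_antisymm (HilbertDepth.h_le K ?_) (HilbertDepth.le_h K (s := s) (by omega) (by omega))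
    rw [hmt, hns]
    push_cast
    linarith
  · have h1 : (2 * t - 1) ^ 2 < 9 + 16 * (s : ℤ) := by
      exact_mod_cast HilbertDepth.sq_lt_of_mem_Ioo (by positivity) ht
    -- With `r = s + 1` it is `t ^ 2 - t - 4 * s - 2`; the split `n = (s + 1) + s` is the extreme
    -- case of `r ≤ s + 1`.
    refine le_antisymm (HilbertDepth.h_le K ?_) (HilbertDepth.le_h K (s := s) (by omega) (by omega))
    rw [hmt, hns]
    push_cast
    linarith
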